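/- Let $E$ and $F$ be real Banach lattices and let $T\colon E\to F$ be a Riesz homomorphism, i.e. a linear map with $T(x\vee y)=Tx\vee Ty$ for all $x,y\in E$, whose range $T(E)$ is closed in $F$. A Banach space has the Schur property if every weakly null sequence in it is norm null; a Banach lattice has the positive Schur property if every weakly null sequence in it formed by positive elements is norm null. Regard $\ker T$ as a Banach lattice with the norm and the order inherited from $E$. (a) If $\ker T$ and $F$ have the positive Schur property, then $E$ has the positive Schur property. (b) If $\ker T$ and $F$ have the Schur property, then $E$ has the Schur property. -/

import Mathlib

open Filter Topology

/-- A real Banach lattice: a vector lattice (Riesz space) over `ℝ` with a complete norm that is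
monotone on absolute values (`|x| ≤ |y| → ‖x‖ ≤ ‖y‖`). -/
class BanachLattice (E : Type*) [NormedAddCommGroup E] [NormedSpace ℝ E] [Lattice E] : Prop
    extends IsOrderedAddMonoid E, IsOrderedModule ℝ E, HasSolidNorm E, CompleteSpace E

/-- A Riesz homomorphism (lattice homomorphism) between real vector lattices: a linear map that
preserves suprema of pairs (hence also infima). Continuity is not part of the definition. -/
structure RieszHom (E F : Type*) [AddCommGroup E] [Module ℝ E] [Lattice E]
    [AddCommGroup F] [Module ℝ F] [Lattice F] extends E →ₗ[ℝ] F where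
  map_sup' : ∀ x y : E, toFun (x ⊔ y) = toFun x ⊔ toFun y

/-- The sequence `x` tends to `0` in the weak topology of the normed space `E`. -/
def WeaklyNull {E : Type*} [NormedAddCommGroup E] [NormedSpace ℝ E] (x : ℕ → E) : Prop :=
  Tendsto (fun n => toWeakSpace ℝ E (x n)) atTop (𝓝 0)

/-- The Schur property: weakly null sequences are norm null. -/
def SchurProperty (E : Type*) [NormedAddCommGroup E] [NormedSpace ℝ E] : Prop :=
  ∀ x : ℕ → E, WeaklyNull x → Tendsto x atTop (𝓝 0)

/-- The positive Schur property: weakly null sequences formed by positive vectors are norm null.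
Only the order relation enters, so that this applies to a linear sublattice, such as the kernel of
a Riesz homomorphism, with the order and the norm it inherits. -/
def PositiveSchurProperty (E : Type*) [NormedAddCommGroup E] [NormedSpace ℝ E]
    [PartialOrder E] : Prop :=
  ∀ x : ℕ → E, (∀ n, 0 ≤ x n) → WeaklyNull x → Tendsto x atTop (𝓝 0)

/-! Positivity makes `T` bounded, so `T xₙ` is weakly null, hence norm null in `F`. As the range is
closed, the open mapping theorem gives a norm null `yₙ` with `T yₙ = T xₙ`. Then `xₙ - yₙ` is weakly
null in `ker T`, hence norm null, and so is `xₙ`. For positive `xₙ`, the correction `|yₙ| ⊓ xₙ`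
replaces `yₙ` to keep the difference positive. -/

section WeaklyNullSequences

variable {E F : Type*} [NormedAddCommGroup E] [NormedSpace ℝ E]
  [NormedAddCommGroup F] [NormedSpace ℝ F]

theorem weaklyNull_iff {x : ℕ → E} :
    WeaklyNull x ↔ ∀ f : StrongDual ℝ E, Tendsto (fun n => f (x n)) atTop (𝓝 0) := by
  have hinj : Function.Injective (topDualPairing ℝ E).flip := fun a b h =>
    (SeparatingDual.eq_iff_forall_dual_eq (R := ℝ)).2 fun f => LinearMap.congr_fun h f
  refine (WeakBilin.tendsto_iff_forall_eval_tendsto (topDualPairing ℝ E).flip hinj).trans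
    (forall_congr' fun f => ?_)
  have h0 : (topDualPairing ℝ E).flip 0 f = 0 := by simp
  change Tendsto (fun n => f (x n)) atTop (𝓝 ((topDualPairing ℝ E).flip 0 f)) ↔ _
  rw [h0]

theorem WeaklyNull.map {x : ℕ → E} (hx : WeaklyNull x) (T : E →L[ℝ] F) :
    WeaklyNull fun n => T (x n) :=
  weaklyNull_iff.2 fun f => weaklyNull_iff.1 hx (f.comp T)

theorem WeaklyNull.sub_of_tendsto {x y : ℕ → E} (hx : WeaklyNull x)
    (hy : Tendsto y atTop (𝓝 0)) : WeaklyNull fun n => x n - y n := by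
  refine weaklyNull_iff.2 fun f => ?_
  simpa using (weaklyNull_iff.1 hx f).sub ((f.continuous.tendsto 0).comp hy)

/-- By Hahn-Banach, a sequence in a subspace that is weakly null in the ambient space is weakly
null in the subspace. -/
theorem WeaklyNull.of_coe {S : Submodule ℝ E} {x : ℕ → S}
    (hx : WeaklyNull fun n => (x n : E)) : WeaklyNull x := by
  refine weaklyNull_iff.2 fun f => ?_
  obtain ⟨g, hg, -⟩ := exists_extension_norm_eq S f
  simpa only [hg] using weaklyNull_iff.1 hx g

/-- A norm null sequence in the range of a bounded operator with closed range lifts to a norm null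
sequence. -/
theorem ContinuousLinearMap.exists_tendsto_zero_lift [CompleteSpace E] [CompleteSpace F]
    (T : E →L[ℝ] F) (hT : IsClosed (Set.range T)) {x : ℕ → E}
    (hx : Tendsto (fun n => T (x n)) atTop (𝓝 0)) :
    ∃ y : ℕ → E, (∀ n, T (y n) = T (x n)) ∧ Tendsto y atTop (𝓝 0) := by
  have hc : IsClosed (T.range : Set F) := hT
  have : CompleteSpace T.range := hc.completeSpace_coe
  -- Open mapping theorem onto the range, a Banach space because it is closed.
  obtain ⟨C, -, hC⟩ := T.rangeRestrict.exists_preimage_norm_le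
    (LinearMap.surjective_rangeRestrict (T : E →ₗ[ℝ] F))
  choose y hy hyC using fun n => hC (T.rangeRestrict (x n))
  refine ⟨y, fun n => congrArg Subtype.val (hy n), ?_⟩
  refine squeeze_zero_norm (a := fun n => C * ‖T (x n)‖) hyC ?_
  simpa only [norm_zero, mul_zero] using hx.norm.const_mul C

end WeaklyNullSequences

namespace RieszHom

section Order

variable {E F : Type*} [AddCommGroup E] [Module ℝ E] [Lattice E]
  [AddCommGroup F] [Module ℝ F] [Lattice F]

theorem map_sup (T : RieszHom E F) (x y : E) :
    T.toLinearMap (x ⊔ y) = T.toLinearMap x ⊔ T.toLinearMap y := T.map_sup' x y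

theorem monotone (T : RieszHom E F) : Monotone T.toLinearMap := fun x y h => by
  rw [← sup_eq_right, ← T.map_sup, sup_eq_right.2 h]

theorem map_abs (T : RieszHom E F) (x : E) : T.toLinearMap |x| = |T.toLinearMap x| := by
  rw [abs, abs, T.map_sup, map_neg]

theorem map_inf [IsOrderedAddMonoid E] [IsOrderedAddMonoid F] (T : RieszHom E F) (x y : E) :
    T.toLinearMap (x ⊓ y) = T.toLinearMap x ⊓ T.toLinearMap y := by
  rw [← neg_neg (x ⊓ y), neg_inf, map_neg, T.map_sup, map_neg, map_neg, ← neg_inf, neg_neg]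

end Order

variable {E F : Type*} [NormedAddCommGroup E] [NormedSpace ℝ E] [Lattice E] [BanachLattice E]
  [NormedAddCommGroup F] [NormedSpace ℝ F] [Lattice F] [BanachLattice F]

/-- Riesz homomorphisms between Banach lattices are automatically bounded. -/
theorem exists_bound (T : RieszHom E F) : ∃ C : ℝ, ∀ x, ‖T.toLinearMap x‖ ≤ C * ‖x‖ := by
  by_contra! h
  choose x hx using fun n : ℕ => h (4 ^ n)
  have hx0 : ∀ n, 0 < ‖x n‖ := fun n => by
    rw [norm_pos_iff]
    intro h0
    simpa [h0] using hx n
  -- These weights make the series converge, while the growth `4 ^ n` still leaves its terms with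
  -- images of norm at least `2 ^ n`, all dominated by `T u`.
  set c : ℕ → ℝ := fun n => (1 / 2) ^ n * ‖x n‖⁻¹ with hc
  have hc0 : ∀ n, 0 < c n := fun n => by have := hx0 n; positivity
  have hsum : Summable fun n => c n • |x n| := by
    refine Summable.of_norm_bounded (g := fun n : ℕ => (1 / 2 : ℝ) ^ n)
      summable_geometric_two fun n => ?_
    rw [norm_smul, norm_abs_eq_norm, Real.norm_of_nonneg (hc0 n).le, hc,
      mul_assoc, inv_mul_cancel₀ (hx0 n).ne', mul_one]
  set u := ∑' n, c n • |x n|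
  have hle : ∀ n, c n • |x n| ≤ u := fun n =>
    hsum.le_tsum n fun j _ => smul_nonneg (hc0 j).le (abs_nonneg _)
  have hb : ∀ n : ℕ, (2 : ℝ) ^ n ≤ ‖T.toLinearMap u‖ := fun n => by
    have h1 : c n • |T.toLinearMap (x n)| ≤ T.toLinearMap u := by
      simpa only [map_smul, T.map_abs] using T.monotone (hle n)
    have h0 : 0 ≤ c n • |T.toLinearMap (x n)| := smul_nonneg (hc0 n).le (abs_nonneg _)
    have h2 := norm_le_norm_of_abs_le_abs
      ((abs_of_nonneg h0).trans_le (h1.trans (le_abs_self _)))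
    rw [norm_smul, norm_abs_eq_norm, Real.norm_of_nonneg (hc0 n).le] at h2
    calc (2 : ℝ) ^ n = c n * (4 ^ n * ‖x n‖) := by
          have hpow : (4 : ℝ) ^ n = 2 ^ n * 2 ^ n := by rw [← mul_pow]; norm_num
          have := (hx0 n).ne'
          simp only [hc, one_div, inv_pow]
          field_simp
          rw [sq, hpow]
      _ ≤ c n * ‖T.toLinearMap (x n)‖ := mul_le_mul_of_nonneg_left (hx n).le (hc0 n).le
      _ ≤ _ := h2
  obtain ⟨n, hn⟩ := pow_unbounded_of_one_lt ‖T.toLinearMap u‖ (one_lt_two (α := ℝ))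
  exact (hb n).not_gt hn

/-- A Riesz homomorphism between Banach lattices as a bounded operator. -/
noncomputable def toCLM (T : RieszHom E F) : E →L[ℝ] F :=
  T.toLinearMap.mkContinuousOfExistsBound T.exists_bound

theorem toCLM_apply (T : RieszHom E F) (x : E) : T.toCLM x = T.toLinearMap x := rfl

theorem schurProperty (T : RieszHom E F) (hT : IsClosed (Set.range T.toLinearMap))
    (hK : SchurProperty (LinearMap.ker T.toLinearMap)) (hF : SchurProperty F) :
    SchurProperty E := by
  intro x hx
  obtain ⟨y, hyx, hy⟩ := T.toCLM.exists_tendsto_zero_lift hT (hF _ (hx.map T.toCLM))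
  have hker : ∀ n, x n - y n ∈ LinearMap.ker T.toLinearMap := fun n => by
    rw [LinearMap.mem_ker, map_sub, sub_eq_zero]
    exact (hyx n).symm
  have h0 := hK (fun n => ⟨x n - y n, hker n⟩) (.of_coe (hx.sub_of_tendsto hy))
  simpa using ((continuous_subtype_val.tendsto _).comp h0).add hy

theorem positiveSchurProperty (T : RieszHom E F) (hT : IsClosed (Set.range T.toLinearMap))
    (hK : PositiveSchurProperty (LinearMap.ker T.toLinearMap)) (hF : PositiveSchurProperty F) :
    PositiveSchurProperty E := by
  intro x hx0 hx
  have hTx0 : ∀ n, 0 ≤ T.toLinearMap (x n) := fun n => by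
    simpa only [map_zero] using T.monotone (hx0 n)
  obtain ⟨y, hyx, hy⟩ := T.toCLM.exists_tendsto_zero_lift hT (hF _ hTx0 (hx.map T.toCLM))
  simp only [toCLM_apply] at hyx
  have hz : Tendsto (fun n => |y n| ⊓ x n) atTop (𝓝 0) := by
    refine squeeze_zero_norm (fun n => ?_) (tendsto_zero_iff_norm_tendsto_zero.1 hy)
    exact norm_le_norm_of_abs_le_abs
      ((abs_of_nonneg (le_inf (abs_nonneg _) (hx0 n))).trans_le inf_le_left)
  -- `T` sends `|yₙ| ⊓ xₙ` to `|T xₙ| ⊓ T xₙ = T xₙ`, since `T xₙ ≥ 0`.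
  have hker : ∀ n, x n - |y n| ⊓ x n ∈ LinearMap.ker T.toLinearMap := fun n => by
    rw [LinearMap.mem_ker, map_sub, T.map_inf, T.map_abs, hyx, abs_of_nonneg (hTx0 n), inf_idem,
      sub_self]
  have h0 := hK (fun n => ⟨x n - |y n| ⊓ x n, hker n⟩) (fun n => sub_nonneg.2 inf_le_right)
    (.of_coe (hx.sub_of_tendsto hz))
  simpa using ((continuous_subtype_val.tendsto _).comp h0).add hz

end RieszHom

theorem proposition2p6
    {E : Type*} [NormedAddCommGroup E] [NormedSpace ℝ E] [Lattice E] [BanachLattice E]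
    {F : Type*} [NormedAddCommGroup F] [NormedSpace ℝ F] [Lattice F] [BanachLattice F]
    (T : RieszHom E F) (hT : IsClosed (Set.range T.toLinearMap)) :
    (PositiveSchurProperty (LinearMap.ker T.toLinearMap) → PositiveSchurProperty F →
      PositiveSchurProperty E) ∧
    (SchurProperty (LinearMap.ker T.toLinearMap) → SchurProperty F → SchurProperty E) :=
  ⟨T.positiveSchurProperty hT, T.schurProperty hT⟩
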